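/- **Setting.** Fix a type $\mathsf{Val}$ of values with a distinguished element $0$, finite types $\mathsf{Var}$ (program variables) and $\mathsf{Lock}$ (locks), and a nonempty type $\mathsf{Reg}$ of registers. Shared variables are the elements of $\mathsf{Lock}\sqcup\mathsf{Var}$; a memory $mem$ maps shared variables to values; a mode state $mds$ maps each mode in $\{\mathrm{AsmNoW},\mathrm{AsmNoRW},\mathrm{GuarNoW},\mathrm{GuarNoRW}\}$ to a set of shared variables. Also fixed are: * a classification $\mathcal L(mem,x)\in\{\mathrm{High},\mathrm{Low}\}$; $y$ is a *control variable* of $x$ if changing only the value of $y$ can change $\mathcal L(\cdot,x)$; * for each lock $k$, sets $W_k,RW_k\subseteq\mathsf{Var}$ (variables *governed* by $k$), a predicate $ev$ on values ("held"), and values $\mathsf{lt},\mathsf{lf}$ with $ev(\mathsf{lt})$, $\neg ev(\mathsf{lf})$. Assumed: control variables and locks are always Low; locks are not control variables; a program variable and its control variables lie in the same sets $W_k$, $RW_k$; no variable is governed by two locks; $W_k\cup RW_k\neq\emptyset$ and $W_k\cap RW_k=\emptyset$; * a register allocator: partial functions $\mathit{alloc}(\Phi,A)$ and $\mathit{cached}(\Phi,A,v)$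 that, when defined, return a register outside the set $A$; the second then satisfies $\Phi(\mathit{cached}(\Phi,A,v))=v$. **Locks and modes.** Acquiring $k$ adds $W_k$ to $\mathrm{AsmNoW}$ and $RW_k$ to $\mathrm{AsmNoRW}$, and removes them from $\mathrm{GuarNoW}$ resp. $\mathrm{GuarNoRW}$; releasing does the opposite. A lock is *correctly held* in $mds$ if $W_k\subseteq mds(\mathrm{AsmNoW})\setminus mds(\mathrm{GuarNoW})$ and $RW_k\subseteq mds(\mathrm{AsmNoRW})\setminus mds(\mathrm{GuarNoRW})$. In both languages below, acquiring $k$ when $\neg ev(mem(k))$ stores $\mathsf{lt}$ in $k$ and updates the modes, and otherwise stutters; releasing $k$ when it is correctly held stores $\mathsf{lf}$ in $k$ and updates the modes, and otherwise stutters. **While.** Expressions: constants, program variables, $e_1\oplus e_2$ for binary operations $\oplus$ on $\mathsf{Val}$. Commands: $\mathsf{skip}$, $v:=e$, $c_1;c_2$, $\mathsf{if}\,e\,c_1\,c_2$, $\mathsf{while}\,e\,c$, $\mathsf{acq}\,k$, $\mathsf{rel}\,k$, and the terminated program $\mathsf{stop}$. Steps are the usual small steps; nonzero means true; $\mathsf{while}\,e\,c$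 steps to $\mathsf{if}\,e\,(c;\mathsf{while}\,e\,c)\,\mathsf{stop}$; if $c_1$ steps to $c_1'$ then $c_1;c_2$ steps to $c_1'\rhd c_2$, where $c_1'\rhd c_2$ is $c_2$ if $c_1'=\mathsf{stop}$ and $c_1';c_2$ otherwise; $\mathsf{stop};c_2$ steps to $c_2$. A command $c'$ is *reachable* from $c$ if it arises by finitely many steps, where memory and modes may be replaced arbitrarily between steps. **RISC.** A text is a list of optionally labelled instructions $\mathsf{load}\,r\,v$, $\mathsf{store}\,v\,r$, $\mathsf{jmp}\,l$, $\mathsf{jz}\,l\,r$, $\mathsf{nop}$, $\mathsf{nop'}$, $\mathsf{movek}\,r\,n$, $\mathsf{mover}\,r\,r'$, $\mathsf{op}\,\oplus\,r\,r'$ ($r:=r\oplus r'$), $\mathsf{acq}\,k$, $\mathsf{rel}\,k$, with labels in $\mathbb N$; $\mathsf{nop'}$ behaves as $\mathsf{nop}$. Configurations carry $(pc,P,regs)$, modes and memory; $\mathsf{jz}$ jumps if its register holds $0$; a label that does not occur in $P$ resolves to $|P|$; stuttering lock instructions keep $pc$. Texts $P_1,P_2$ are *joinable* if $P_1$ jumps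 only to labels of its own instructions and to the label of the first instruction of $P_2$, and $P_2$ does not jump to labels of $P_1$. **Records.** A compilation record $C=(\Phi,\mathcal S)$ has a register record, i.e. a partial map $\Phi$ from registers to expressions, and an assumption record $\mathcal S=(\mathcal S_1,\mathcal S_2)$, i.e. two sets of shared variables. A program variable is *stable* for $\mathcal S$ if it and all its control variables lie in $\mathcal S_1\cup\mathcal S_2$. $C$ is *register stable* if all variables of all expressions in the range of $\Phi$ are stable for $\mathcal S$. $C$ is *consistent* with $regs,mds,mem$ if $\Phi(r)=e$ implies that $regs(r)$ is the value of $e$ in $mem$, and $\mathcal S=(mds(\mathrm{AsmNoW}),mds(\mathrm{AsmNoRW}))$. **Compiler.** $\mathsf{compileExpr}\,C\,A\,l\,e$ returns a text annotated with the record before each instruction, a result register, a final record and a failure flag; $l$ labels the first instruction emitted. A constant is moved to an allocated register; a variable is found in a cached register (no code) or loaded to an allocated one; for $e_1\oplus e_2$, code for $e_1$, then code for $e_2$ with the result register $r_1$ of $e_1$ added to $A$, then $\mathsf{op}\oplus r_1\,r_2$. The register record is updated accordingly; it fails iff an allocation fails. $\mathsf{compileCmd}\,C\,l\,nl\,c$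 (with an optional initial label $l$ and the next fresh label $nl$) returns $(PCs,l',nl',C',failed)$, where $PCs$ is an annotated text and $l'$ is the label owed to the next instruction, if any. $l$ is put on the first instruction. $\mathsf{skip}$: $\mathsf{nop}$. $v:=e$: code for $e$ and $\mathsf{store}$; entries mentioning $v$ are dropped. $c_1;c_2$: consecutive compilation and concatenation. $\mathsf{if}\,e\,c_1\,c_2$: code $P_e$ for $e$ (final record $C_1$), $\mathsf{jz}\,br\,r$, code $P_1$ for $c_1$ from $C_1$ (initial label none, fresh label $nl+2$), $\mathsf{jmp}\,ex$, code $P_2$ for $c_2$ from $C_1$ (initial label $br$), $\mathsf{nop'}$, with $br=nl$, $ex=nl+1$, $l'=ex$; the final register record keeps the entries on which both branches agree and the final assumption record is that of the first branch. $\mathsf{while}\,e\,c$: the register record is emptied; code $P_e$ for $e$ (final record $C_1$), $\mathsf{jz}\,ex\,r$, code $P_b$ for $c$ from $C_1$ (initial label none), $\mathsf{jmp}\,lp$, where $lp$ is $l$ if present and otherwise fresh, $ex$ is fresh, $l'=ex$, and the final record is $C_1$. $\mathsf{acq}\,k$, $\mathsf{rel}\,k$: the corresponding instruction; $\mathcal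 S_1,\mathcal S_2$ gain resp. lose $W_k,RW_k$, and $\mathsf{rel}$ drops the entries that are no longer stable. Labels owed by a part are put on the instruction that follows it. $failed$ is true iff a part fails, or $\mathsf{stop}$ occurs as a command to be compiled, or the *input requirements* on $(C,l,nl,c)$ are violated. These requirements are: $C$ is register stable; $c\neq\mathsf{stop}$; if $l=x$ then $x<nl$; and, carrying the assumption record $\mathcal S$ through $c$ from that of $C$, all expressions evaluated mention stable variables only, unstable variables that are assigned to are not governed by any lock, both branches of each conditional end with the same $\mathcal S$, and each loop body restores $\mathcal S$. **The relation $\mathcal R_{wr}$.** It is the least relation between While configurations $\langle c,mds,mem\rangle$ and RISC configurations $\langle (pc,P,regs),mds,mem\rangle$ closed under the following rules (related configurations share $mds$ and $mem$, which are omitted; all compiler runs mentioned are successful; runs on the command itself, and both runs in *seq*, satisfy the input requirements; "OK at $pc$" means that the record annotating instruction $pc$ is register stable and consistent with the present $regs,mds,mem$; "$c\sim P$ from $C_1$" means that, if $C_1$ is register stable, then $\langle c\rangle$ and $\langle(0,P,regs')\rangle$ are related under every $mds',mem'$ such that $C_1$ is consistent with $regs',mds',mem'$). * *stop*: $\mathsf{stop}$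 with $pc=|P|$. * *skip\_nop*, *lock\_acq*, *lock\_rel*: $\mathsf{skip}$, $\mathsf{acq}\,k$, $\mathsf{rel}\,k$ with $pc=0$ in the one-instruction text $\mathsf{nop}$, $\mathsf{acq}\,k$, $\mathsf{rel}\,k$. * *assign\_expr* / *assign\_store*: $v:=e$ with its compiled text, at $pc<|P_e|$ / at the store $pc=|P_e|$, OK at $pc$; at the store, $v$ is stable if governed by a lock. * *seq*: $c_1'\rhd c_2$ with $P_1P_2$ at $pc<|P_1|$, where $P_1,P_2$ are the outputs of consecutive compilation of some $c_1$ and of $c_2$, joinable, $c_1'$ is reachable from $c_1$ and related to $pc$ in $P_1$, OK at $pc$, and $c_2\sim P_2$ from the final record of $c_1$. * *join*: $c$ with $P_1P_2$ at $pc\ge|P_1|$, if $P_1,P_2$ are joinable and $c$ is related to $pc-|P_1|$ in $P_2$. * *if\_expr*: $\mathsf{if}\,e\,c_1\,c_2$ with its compiled text at $pc\le|P_e|$, OK at $pc$, $c_1\sim P_1$ and $c_2\sim P_2$ from $C_1$. * *if\_c1*, *if\_c2*: $c_i'$ reachable from $c_i$ with the compiled text of $\mathsf{if}\,e\,c_1\,c_2$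 at the position of an instruction of $P_i$, OK there, if $c_i'$ is related to the corresponding position in $P_i$. * *epilogue\_step*: $\mathsf{stop}$ with a position holding $\mathsf{jmp}$ or $\mathsf{nop'}$, if $\mathsf{stop}$ is related to every RISC successor configuration. * *while\_expr*: with the compiled text of $\mathsf{while}\,e\,c$ at $pc\le|P_e|$: $\mathsf{while}\,e\,c$ if $pc=0$, and $\mathsf{if}\,e\,(c;\mathsf{while}\,e\,c)\,\mathsf{stop}$ if $pc>0$; OK at $pc$ and $c\sim P_b$ from $C_1$. * *while\_inner*: $c_I;\mathsf{while}\,e\,c$ at the position of an instruction of $P_b$, where $c_I\ne\mathsf{stop}$ is reachable from $c$ and related to the corresponding position in $P_b$; OK there and $c\sim P_b$ from $C_1$. * *while\_loop*: $\mathsf{while}\,e\,c$ at the position of an instruction of $P_b$ or at the final $\mathsf{jmp}$, if $\mathsf{stop}$ is related to the corresponding position in $P_b$ (the end of $P_b$ in the second case); OK there and $c\sim P_b$ from $C_1$. **Theorem (successful compilations are refinements in $\mathcal R_{wr}$).** Suppose $(PCs,l',nl',C',failed)=\mathsf{compileCmd}\,C\,l\,nl\,c$ with $failed=\mathrm{False}$,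 the input requirements on $(C,l,nl,c)$ hold, $C$ is consistent with $regs,mds,mem$, and $P$ is the text of $PCs$ without annotations. Then $$\bigl(\langle c,mds,mem\rangle,\ \langle(0,P,regs),mds,mem\rangle\bigr)\in\mathcal R_{wr}.$$ -/

import Mathlib

/-! Source and target languages with mutex locks, the compiler between them, and the
refinement relation. -/

noncomputable section

universe u₁ u₂ u₃ u₄

/-! ### Shared memory, modes, locking discipline -/

/-- Shared variables: lock variables `Sum.inl k` and program variables `Sum.inr v`. -/
abbrev SVar (Var : Type u₂) (Lock : Type u₃) := Lock ⊕ Var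

/-- Shared memory. -/
abbrev Mem (Val : Type u₁) (Var : Type u₂) (Lock : Type u₃) := SVar Var Lock → Val

/-- Assume-guarantee modes. -/
inductive Mode where
  | asmNoW
  | asmNoRW
  | guarNoW
  | guarNoRW

/-- Mode states. -/
abbrev Mds (Var : Type u₂) (Lock : Type u₃) := Mode → Set (SVar Var Lock)

/-- Sensitivity levels. -/
inductive Level where
  | high
  | low

/-- The control variables of `x`: those whose value can influence the classification of `x`. -/
def ctrlVars {Val : Type u₁} {Var : Type u₂} {Lock : Type u₃}
    (dma : Mem Val Var Lock → SVar Var Lock → Level) (x : SVar Var Lock) :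
    Set (SVar Var Lock) :=
  {y | ∃ m m' : Mem Val Var Lock, (∀ z, z ≠ y → m z = m' z) ∧ dma m x ≠ dma m' x}

/-- What the developer supplies: the value-dependent classification, the lock interpretation,
and the values that represent held and free locks, subject to the cleanliness conditions on
locking disciplines. -/
structure LockSystem (Val : Type u₁) (Var : Type u₂) (Lock : Type u₃) where
  /-- value-dependent classification -/
  dma : Mem Val Var Lock → SVar Var Lock → Level
  /-- program variables to which holding the lock grants exclusive write permission -/
  noW : Lock → Set Var
  /-- program variables to which holding the lock grants exclusive read and write permission -/
  noRW : Lock → Set Var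
  /-- does a value of a lock variable mean that the lock is held? -/
  evLock : Val → Prop
  /-- the value stored by acquiring a lock -/
  lockTrue : Val
  /-- the value stored by releasing a lock -/
  lockFalse : Val
  evLock_true : evLock lockTrue
  evLock_false : ¬ evLock lockFalse
  /-- control variables are statically low -/
  ctrl_low : ∀ x, ∀ y ∈ ctrlVars dma x, ∀ m, dma m y = Level.low
  /-- locks are not control variables -/
  lock_not_ctrl : ∀ (k : Lock) (x : SVar Var Lock), Sum.inl k ∉ ctrlVars dma x
  /-- locks are statically low -/
  lock_low : ∀ (k : Lock) (m : Mem Val Var Lock), dma m (Sum.inl k) = Level.low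
  /-- a variable and its control variables are governed alike -/
  ctrl_governed : ∀ (c v : Var) (k : Lock),
    (Sum.inr c : SVar Var Lock) ∈ ctrlVars dma (Sum.inr v) →
      (c ∈ noW k ↔ v ∈ noW k) ∧ (c ∈ noRW k ↔ v ∈ noRW k)
  /-- no variable is governed by two locks -/
  governed_unique : ∀ (v : Var) (k k' : Lock),
    v ∈ noW k ∪ noRW k → v ∈ noW k' ∪ noRW k' → k' = k
  /-- every lock governs some variable -/
  governed_nonempty : ∀ k : Lock, noW k ∪ noRW k ≠ ∅
  /-- the two sets of a lock do not overlap -/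
  governed_disjoint : ∀ k : Lock, noW k ∩ noRW k = ∅

section Locks

variable {Val : Type u₁} {Var : Type u₂} {Lock : Type u₃}

/-- `noW k` as a set of shared variables. -/
def LockSystem.noWvars (S : LockSystem Val Var Lock) (k : Lock) : Set (SVar Var Lock) :=
  Sum.inr '' S.noW k

/-- `noRW k` as a set of shared variables. -/
def LockSystem.noRWvars (S : LockSystem Val Var Lock) (k : Lock) : Set (SVar Var Lock) :=
  Sum.inr '' S.noRW k

/-- The program variable `v` is governed by some lock. -/
def LockSystem.Governed (S : LockSystem Val Var Lock) (v : Var) : Prop :=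
  ∃ k, v ∈ S.noW k ∪ S.noRW k

/-- Effect on the mode state of acquiring `k`. -/
def lockAcqUpd (S : LockSystem Val Var Lock) (mds : Mds Var Lock) (k : Lock) : Mds Var Lock
  | Mode.guarNoW => mds Mode.guarNoW \ S.noWvars k
  | Mode.asmNoW => mds Mode.asmNoW ∪ S.noWvars k
  | Mode.guarNoRW => mds Mode.guarNoRW \ S.noRWvars k
  | Mode.asmNoRW => mds Mode.asmNoRW ∪ S.noRWvars k

/-- Effect on the mode state of releasing `k`. -/
def lockRelUpd (S : LockSystem Val Var Lock) (mds : Mds Var Lock) (k : Lock) : Mds Var Lock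
  | Mode.guarNoW => mds Mode.guarNoW ∪ S.noWvars k
  | Mode.asmNoW => mds Mode.asmNoW \ S.noWvars k
  | Mode.guarNoRW => mds Mode.guarNoRW ∪ S.noRWvars k
  | Mode.asmNoRW => mds Mode.asmNoRW \ S.noRWvars k

/-- The mode state is consistent with holding `k`. -/
def LockHeldMdsCorrect (S : LockSystem Val Var Lock) (mds : Mds Var Lock) (k : Lock) : Prop :=
  ∀ x, (x ∈ S.noWvars k → x ∉ mds Mode.guarNoW ∧ x ∈ mds Mode.asmNoW) ∧
    (x ∈ S.noRWvars k → x ∉ mds Mode.guarNoRW ∧ x ∈ mds Mode.asmNoRW)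

/-- Memory after storing `n` in the shared variable `x`. -/
def Mem.set (mem : Mem Val Var Lock) (x : SVar Var Lock) (n : Val) : Mem Val Var Lock :=
  open Classical in Function.update mem x n

end Locks

/-- Local configurations: thread-private state, mode state, shared memory. -/
structure LocalConf (T : Type u₄) (Val : Type u₁) (Var : Type u₂) (Lock : Type u₃) where
  tps : T
  mds : Mds Var Lock
  mem : Mem Val Var Lock

/-! ### Expressions and the `While` language -/

/-- Expressions over program variables. -/
inductive Expr (Val : Type u₁) (Var : Type u₂) where
  | const (n : Val)
  | var (v : Var)
  | op (f : Val → Val → Val) (e₁ e₂ : Expr Val Var)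

/-- Value of an expression. -/
def Expr.eval {Val : Type u₁} {Var : Type u₂} {Lock : Type u₃} (mem : Mem Val Var Lock) :
    Expr Val Var → Val
  | .const n => n
  | .var v => mem (Sum.inr v)
  | .op f e₁ e₂ => f (e₁.eval mem) (e₂.eval mem)

/-- Variables of an expression. -/
def Expr.vars {Val : Type u₁} {Var : Type u₂} : Expr Val Var → Set Var
  | .const _ => ∅
  | .var v => {v}
  | .op _ e₁ e₂ => e₁.vars ∪ e₂.vars

/-- Commands; `halt` is the terminated program. -/
inductive Cmd (Val : Type u₁) (Var : Type u₂) (Lock : Type u₃) where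
  | halt
  | skip
  | assign (v : Var) (e : Expr Val Var)
  | seq (c₁ c₂ : Cmd Val Var Lock)
  | ite (e : Expr Val Var) (c₁ c₂ : Cmd Val Var Lock)
  | loop (e : Expr Val Var) (c : Cmd Val Var Lock)
  | lockAcq (k : Lock)
  | lockRel (k : Lock)

section While

variable {Val : Type u₁} {Var : Type u₂} {Lock : Type u₃}

/-- What remains of a sequence when `c₁` remains of its first part. -/
def seqCont (c₁ c₂ : Cmd Val Var Lock) : Cmd Val Var Lock :=
  match c₁ with
  | .halt => c₂
  | c₁ => .seq c₁ c₂

/-- Evaluation steps of `While`. A value counts as true when it is nonzero. A sequence goes on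
with its second part in the very step that terminates the first. -/
inductive WhileStep [Zero Val] (S : LockSystem Val Var Lock) :
    LocalConf (Cmd Val Var Lock) Val Var Lock →
      LocalConf (Cmd Val Var Lock) Val Var Lock → Prop
  | skip (mds mem) : WhileStep S ⟨.skip, mds, mem⟩ ⟨.halt, mds, mem⟩
  | assign (v e mds mem) :
      WhileStep S ⟨.assign v e, mds, mem⟩ ⟨.halt, mds, mem.set (Sum.inr v) (e.eval mem)⟩
  | seq (c₁ c₁' c₂ mds mds' mem mem') :
      WhileStep S ⟨c₁, mds, mem⟩ ⟨c₁', mds', mem'⟩ →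
      WhileStep S ⟨.seq c₁ c₂, mds, mem⟩ ⟨seqCont c₁' c₂, mds', mem'⟩
  | seq_halt (c₂ mds mem) : WhileStep S ⟨.seq .halt c₂, mds, mem⟩ ⟨c₂, mds, mem⟩
  | ite_true (e c₁ c₂ mds mem) : e.eval mem ≠ 0 →
      WhileStep S ⟨.ite e c₁ c₂, mds, mem⟩ ⟨c₁, mds, mem⟩
  | ite_false (e c₁ c₂ mds mem) : e.eval mem = 0 →
      WhileStep S ⟨.ite e c₁ c₂, mds, mem⟩ ⟨c₂, mds, mem⟩
  | loop (e c mds mem) :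
      WhileStep S ⟨.loop e c, mds, mem⟩ ⟨.ite e (.seq c (.loop e c)) .halt, mds, mem⟩
  | lock_acq (k mds mem) : ¬ S.evLock (mem (Sum.inl k)) →
      WhileStep S ⟨.lockAcq k, mds, mem⟩
        ⟨.halt, lockAcqUpd S mds k, mem.set (Sum.inl k) S.lockTrue⟩
  | lock_spin (k mds mem) : S.evLock (mem (Sum.inl k)) →
      WhileStep S ⟨.lockAcq k, mds, mem⟩ ⟨.lockAcq k, mds, mem⟩
  | lock_rel (k mds mem) : LockHeldMdsCorrect S mds k →
      WhileStep S ⟨.lockRel k, mds, mem⟩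
        ⟨.halt, lockRelUpd S mds k, mem.set (Sum.inl k) S.lockFalse⟩
  | lock_invalid (k mds mem) : ¬ LockHeldMdsCorrect S mds k →
      WhileStep S ⟨.lockRel k, mds, mem⟩ ⟨.lockRel k, mds, mem⟩

/-- The program `c'` is reachable from `c` by evaluation steps, where memory and modes may be
replaced arbitrarily between the steps (this covers interference by other threads). -/
def CmdReach [Zero Val] (S : LockSystem Val Var Lock) : Cmd Val Var Lock →
    Cmd Val Var Lock → Prop :=
  Relation.ReflTransGen fun c c' => ∃ mds mem mds' mem', WhileStep S ⟨c, mds, mem⟩ ⟨c', mds', mem'⟩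

end While

/-! ### The `RISC` language. Labels are natural numbers. -/

/-- Instructions. `nopEnd` behaves as `nop`; the compiler emits it only for control flow at the end
of a conditional, so that it is told apart from the code of `skip`. -/
inductive Instr (Val : Type u₁) (Var : Type u₂) (Lock : Type u₃) (Reg : Type u₄) where
  | load (r : Reg) (v : Var)
  | store (v : Var) (r : Reg)
  | jmp (l : ℕ)
  | jz (l : ℕ) (r : Reg)
  | nop
  | nopEnd
  | moveK (r : Reg) (n : Val)
  | moveR (r r' : Reg)
  | op (f : Val → Val → Val) (r r' : Reg)
  | lockAcq (k : Lock)
  | lockRel (k : Lock)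

/-- Program texts: lists of optionally labelled instructions. -/
abbrev Text (Val : Type u₁) (Var : Type u₂) (Lock : Type u₃) (Reg : Type u₄) :=
  List (Option ℕ × Instr Val Var Lock Reg)

/-- Thread-private state of a `RISC` thread: program counter, program text, register bank. -/
structure RiscState (Val : Type u₁) (Var : Type u₂) (Lock : Type u₃) (Reg : Type u₄) where
  pc : ℕ
  text : Text Val Var Lock Reg
  regs : Reg → Val

section Risc

variable {Val : Type u₁} {Var : Type u₂} {Lock : Type u₃} {Reg : Type u₄}

/-- The position of the instruction labelled `l`; a label that does not occur in the text
resolves to the end of the text. -/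
def resolve (P : Text Val Var Lock Reg) (l : ℕ) : ℕ :=
  P.findIdx fun i => i.1 == some l

/-- Register bank after writing `n` to `r`. -/
def setReg (regs : Reg → Val) (r : Reg) (n : Val) : Reg → Val :=
  open Classical in Function.update regs r n

/-- Execution of one fetched instruction, at program counter `pc` of the text `P`. -/
inductive InstrStep [Zero Val] (S : LockSystem Val Var Lock) (P : Text Val Var Lock Reg)
    (pc : ℕ) (regs : Reg → Val) (mds : Mds Var Lock) (mem : Mem Val Var Lock) :
    Instr Val Var Lock Reg → LocalConf (RiscState Val Var Lock Reg) Val Var Lock → Prop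
  | load (r v) : InstrStep S P pc regs mds mem (.load r v)
      ⟨⟨pc + 1, P, setReg regs r (mem (Sum.inr v))⟩, mds, mem⟩
  | store (v r) : InstrStep S P pc regs mds mem (.store v r)
      ⟨⟨pc + 1, P, regs⟩, mds, mem.set (Sum.inr v) (regs r)⟩
  | jmp (l) : InstrStep S P pc regs mds mem (.jmp l) ⟨⟨resolve P l, P, regs⟩, mds, mem⟩
  | jz_jump (l r) : regs r = 0 →
      InstrStep S P pc regs mds mem (.jz l r) ⟨⟨resolve P l, P, regs⟩, mds, mem⟩
  | jz_next (l r) : regs r ≠ 0 →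
      InstrStep S P pc regs mds mem (.jz l r) ⟨⟨pc + 1, P, regs⟩, mds, mem⟩
  | nop : InstrStep S P pc regs mds mem .nop ⟨⟨pc + 1, P, regs⟩, mds, mem⟩
  | nopEnd : InstrStep S P pc regs mds mem .nopEnd ⟨⟨pc + 1, P, regs⟩, mds, mem⟩
  | moveK (r n) : InstrStep S P pc regs mds mem (.moveK r n)
      ⟨⟨pc + 1, P, setReg regs r n⟩, mds, mem⟩
  | moveR (r r') : InstrStep S P pc regs mds mem (.moveR r r')
      ⟨⟨pc + 1, P, setReg regs r (regs r')⟩, mds, mem⟩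
  | op (f r r') : InstrStep S P pc regs mds mem (.op f r r')
      ⟨⟨pc + 1, P, setReg regs r (f (regs r) (regs r'))⟩, mds, mem⟩
  | lock_acq (k) : ¬ S.evLock (mem (Sum.inl k)) →
      InstrStep S P pc regs mds mem (.lockAcq k)
        ⟨⟨pc + 1, P, regs⟩, lockAcqUpd S mds k, mem.set (Sum.inl k) S.lockTrue⟩
  | lock_spin (k) : S.evLock (mem (Sum.inl k)) →
      InstrStep S P pc regs mds mem (.lockAcq k) ⟨⟨pc, P, regs⟩, mds, mem⟩
  | lock_rel (k) : LockHeldMdsCorrect S mds k →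
      InstrStep S P pc regs mds mem (.lockRel k)
        ⟨⟨pc + 1, P, regs⟩, lockRelUpd S mds k, mem.set (Sum.inl k) S.lockFalse⟩
  | lock_invalid (k) : ¬ LockHeldMdsCorrect S mds k →
      InstrStep S P pc regs mds mem (.lockRel k) ⟨⟨pc, P, regs⟩, mds, mem⟩

/-- Evaluation steps of `RISC`; there is none when the program counter is outside the text. -/
def RiscStep [Zero Val] (S : LockSystem Val Var Lock)
    (a b : LocalConf (RiscState Val Var Lock Reg) Val Var Lock) : Prop :=
  ∃ i, a.tps.text[a.tps.pc]? = some i ∧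
    InstrStep S a.tps.text a.tps.pc a.tps.regs a.mds a.mem i.2 b

/-- The label an instruction may jump to. -/
def Instr.target : Instr Val Var Lock Reg → Option ℕ
  | .jmp l => some l
  | .jz l _ => some l
  | _ => none

/-- Labels of the instructions of a text. -/
def labels (P : Text Val Var Lock Reg) : Set ℕ := {l | ∃ i ∈ P, i.1 = some l}

/-- Labels to which a text may jump. -/
def jumps (P : Text Val Var Lock Reg) : Set ℕ := {l | ∃ i ∈ P, i.2.target = some l}

/-- `P₁` jumps only to its own labels and to the label of the first instruction of `P₂`. -/
def JoinableFwd (P₁ P₂ : Text Val Var Lock Reg) : Prop :=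
  ∀ l ∈ jumps P₁, l ∈ labels P₁ ∨ ∃ i, P₂.head? = some i ∧ i.1 = some l

/-- `P₂` does not jump to labels of `P₁`. -/
def JoinableBwd (P₁ P₂ : Text Val Var Lock Reg) : Prop :=
  ∀ l ∈ jumps P₂, l ∉ labels P₁

/-- Self-contained control flow of two consecutive program texts. -/
def Joinable (P₁ P₂ : Text Val Var Lock Reg) : Prop :=
  JoinableFwd P₁ P₂ ∧ JoinableBwd P₁ P₂

end Risc

/-! ### Compilation records -/

/-- Register records. -/
abbrev RegRec (Val : Type u₁) (Var : Type u₂) (Reg : Type u₄) := Reg → Option (Expr Val Var)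

/-- Assumption records: the variables recorded to carry the assumption `asmNoW`, respectively
`asmNoRW`. -/
abbrev AsmRec (Var : Type u₂) (Lock : Type u₃) := Set (SVar Var Lock) × Set (SVar Var Lock)

/-- Compilation records. -/
structure CompRec (Val : Type u₁) (Var : Type u₂) (Lock : Type u₃) (Reg : Type u₄) where
  reg : RegRec Val Var Reg
  asm : AsmRec Var Lock

/-- Program texts in which each instruction is annotated with the compilation record that
describes the state before its execution. -/
abbrev AText (Val : Type u₁) (Var : Type u₂) (Lock : Type u₃) (Reg : Type u₄) :=
  List ((Option ℕ × Instr Val Var Lock Reg) × CompRec Val Var Lock Reg)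

/-- A register allocation scheme. Both functions avoid the registers in the given set and may
fail; the second looks for a register that is recorded as already holding a variable. -/
structure RegAlloc (Val : Type u₁) (Var : Type u₂) (Reg : Type u₄) where
  alloc : RegRec Val Var Reg → Set Reg → Option Reg
  allocCached : RegRec Val Var Reg → Set Reg → Var → Option Reg
  alloc_avoids : ∀ Φ A r, alloc Φ A = some r → r ∉ A
  allocCached_avoids : ∀ Φ A v r, allocCached Φ A v = some r → r ∉ A
  allocCached_holds : ∀ Φ A v r, allocCached Φ A v = some r → Φ r = some (Expr.var v)

section Records

variable {Val : Type u₁} {Var : Type u₂} {Lock : Type u₃} {Reg : Type u₄}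

/-- The variable `v` is stable according to the assumption record. -/
def VarStable (S : LockSystem Val Var Lock) (A : AsmRec Var Lock) (v : Var) : Prop :=
  Sum.inr v ∈ A.1 ∪ A.2 ∧ ∀ v' ∈ ctrlVars S.dma (Sum.inr v), v' ∈ A.1 ∪ A.2

/-- All variables of `e` are stable. -/
def ExprStable (S : LockSystem Val Var Lock) (A : AsmRec Var Lock) (e : Expr Val Var) : Prop :=
  ∀ v ∈ e.vars, VarStable S A v

/-- All expressions in the register record are stable. -/
def RegrecStable (S : LockSystem Val Var Lock) (C : CompRec Val Var Lock Reg) : Prop :=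
  ∀ r e, C.reg r = some e → ExprStable S C.asm e

/-- Consistency of a register record with registers and shared memory. -/
def RegrecMemConsistent (Φ : RegRec Val Var Reg) (regs : Reg → Val) (mem : Mem Val Var Lock) :
    Prop :=
  ∀ r e, Φ r = some e → regs r = e.eval mem

/-- Consistency of an assumption record with a mode state. -/
def AsmrecMdsConsistent (A : AsmRec Var Lock) (mds : Mds Var Lock) : Prop :=
  A = (mds Mode.asmNoW, mds Mode.asmNoRW)

/-- Configuration consistency requirements for compiled commands. -/
def CompiledCmdConfigConsistent (C : CompRec Val Var Lock Reg) (regs : Reg → Val)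
    (mds : Mds Var Lock) (mem : Mem Val Var Lock) : Prop :=
  RegrecMemConsistent C.reg regs mem ∧ AsmrecMdsConsistent C.asm mds

/-- Record that register `r` holds the value of `e`. -/
def CompRec.record (C : CompRec Val Var Lock Reg) (r : Reg) (e : Expr Val Var) :
    CompRec Val Var Lock Reg :=
  ⟨open Classical in Function.update C.reg r (some e), C.asm⟩

/-- Keep only the register record entries that satisfy `p`. -/
def RegRec.keep (Φ : RegRec Val Var Reg) (p : Expr Val Var → Prop) : RegRec Val Var Reg :=
  fun r => open Classical in (Φ r).filter fun e => decide (p e)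

/-- The mappings on which two register records agree. -/
def RegRec.meet (Φ Φ' : RegRec Val Var Reg) : RegRec Val Var Reg :=
  fun r => open Classical in if Φ r = Φ' r then Φ r else none

/-- Flush all register record entries. -/
def CompRec.flush (C : CompRec Val Var Lock Reg) : CompRec Val Var Lock Reg :=
  ⟨fun _ => none, C.asm⟩

/-- Effect on the assumption record of acquiring `k`. -/
def asmAcq (S : LockSystem Val Var Lock) (A : AsmRec Var Lock) (k : Lock) : AsmRec Var Lock :=
  (A.1 ∪ S.noWvars k, A.2 ∪ S.noRWvars k)

/-- Effect on the assumption record of releasing `k`. -/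
def asmRel (S : LockSystem Val Var Lock) (A : AsmRec Var Lock) (k : Lock) : AsmRec Var Lock :=
  (A.1 \ S.noWvars k, A.2 \ S.noRWvars k)

/-- The assumption record at the end of a command. -/
def asmAfter (S : LockSystem Val Var Lock) : Cmd Val Var Lock → AsmRec Var Lock → AsmRec Var Lock
  | .seq c₁ c₂, A => asmAfter S c₂ (asmAfter S c₁ A)
  | .ite _ c₁ _, A => asmAfter S c₁ A
  | .lockAcq k, A => asmAcq S A k
  | .lockRel k, A => asmRel S A k
  | _, A => A

/-- The stability checks, as a recursion that carries the assumption record along: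
expressions mention stable variables only; unstable variables are assigned to only if no lock
governs them; both branches of a conditional end with the same assumptions; and loop bodies
restore the assumptions held on entry. -/
def stabilityChecksAsm (S : LockSystem Val Var Lock) : Cmd Val Var Lock → AsmRec Var Lock → Prop
  | .assign v e, A => ExprStable S A e ∧ (¬ VarStable S A v → ¬ S.Governed v)
  | .seq c₁ c₂, A => stabilityChecksAsm S c₁ A ∧ stabilityChecksAsm S c₂ (asmAfter S c₁ A)
  | .ite e c₁ c₂, A => ExprStable S A e ∧ stabilityChecksAsm S c₁ A ∧
      stabilityChecksAsm S c₂ A ∧ asmAfter S c₁ A = asmAfter S c₂ A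
  | .loop e c, A => ExprStable S A e ∧ stabilityChecksAsm S c A ∧ asmAfter S c A = A
  | _, _ => True

/-- The stability checks on a command and an initial compilation record. -/
def StabilityChecks (S : LockSystem Val Var Lock) (c : Cmd Val Var Lock)
    (C : CompRec Val Var Lock Reg) : Prop :=
  stabilityChecksAsm S c C.asm

/-- Requirements on inputs to the compiler. -/
def CompilerInputReqs (S : LockSystem Val Var Lock) (C : CompRec Val Var Lock Reg)
    (l : Option ℕ) (nl : ℕ) (c : Cmd Val Var Lock) : Prop :=
  StabilityChecks S c C ∧ RegrecStable S C ∧ c ≠ .halt ∧ ∀ x, l = some x → x < nl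

end Records

/-! ### The compiler -/

/-- Output of the expression compiler: annotated text, register that holds the result, final
compilation record, failure flag. -/
structure ExprOut (Val : Type u₁) (Var : Type u₂) (Lock : Type u₃) (Reg : Type u₄) where
  code : AText Val Var Lock Reg
  reg : Reg
  final : CompRec Val Var Lock Reg
  failed : Bool

/-- Output of the command compiler: annotated text, label owed to the next instruction, next
fresh label, final compilation record, failure flag. -/
structure CmdOut (Val : Type u₁) (Var : Type u₂) (Lock : Type u₃) (Reg : Type u₄) where
  code : AText Val Var Lock Reg
  label : Option ℕ
  next : ℕ
  final : CompRec Val Var Lock Reg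
  failed : Bool

section Compiler

variable {Val : Type u₁} {Var : Type u₂} {Lock : Type u₃} {Reg : Type u₄}

/-- Expression compiler; `A` is the set of registers that must not be overwritten, `l` the label
for the first instruction. -/
def compileExpr [Inhabited Reg] (R : RegAlloc Val Var Reg) :
    CompRec Val Var Lock Reg → Set Reg → Option ℕ → Expr Val Var → ExprOut Val Var Lock Reg
  | C, A, l, .const n =>
    match R.alloc C.reg A with
    | some r => ⟨[((l, .moveK r n), C)], r, C.record r (.const n), false⟩
    | none => ⟨[], default, C, true⟩
  | C, A, l, .var v =>
    match R.allocCached C.reg A v with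
    | some r => ⟨[], r, C, false⟩
    | none =>
      match R.alloc C.reg A with
      | some r => ⟨[((l, .load r v), C)], r, C.record r (.var v), false⟩
      | none => ⟨[], default, C, true⟩
  | C, A, l, .op f e₁ e₂ =>
    let o₁ := compileExpr R C A l e₁
    let l₂ := if o₁.code.isEmpty then l else none
    let o₂ := compileExpr R o₁.final (insert o₁.reg A) l₂ e₂
    let l₃ := if o₂.code.isEmpty then l₂ else none
    ⟨o₁.code ++ o₂.code ++ [((l₃, .op f o₁.reg o₂.reg), o₂.final)], o₁.reg,
      o₂.final.record o₁.reg (.op f e₁ e₂), o₁.failed || o₂.failed⟩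

/-- Label of the head of a loop: the initial label if there is one, otherwise a fresh one. -/
def loopLabel (l : Option ℕ) (nl : ℕ) : ℕ := l.getD nl

/-- Exit label of a loop. -/
def exitLabel (l : Option ℕ) (nl : ℕ) : ℕ := if l.isSome then nl else nl + 1

/-- Translation of commands. -/
def compileCode [Inhabited Reg] (S : LockSystem Val Var Lock) (R : RegAlloc Val Var Reg) :
    CompRec Val Var Lock Reg → Option ℕ → ℕ → Cmd Val Var Lock → CmdOut Val Var Lock Reg
  | C, _, nl, .halt => ⟨[], none, nl, C, true⟩
  | C, l, nl, .skip => ⟨[((l, .nop), C)], none, nl, C, false⟩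
  | C, l, nl, .assign v e =>
    let o := compileExpr R C ∅ l e
    ⟨o.code ++ [((if o.code.isEmpty then l else none, .store v o.reg), o.final)], none, nl,
      ⟨o.final.reg.keep fun e' => v ∉ e'.vars, o.final.asm⟩, o.failed⟩
  | C, l, nl, .seq c₁ c₂ =>
    let o₁ := compileCode S R C l nl c₁
    let o₂ := compileCode S R o₁.final o₁.label o₁.next c₂
    ⟨o₁.code ++ o₂.code, o₂.label, o₂.next, o₂.final, o₁.failed || o₂.failed⟩
  | C, l, nl, .ite e c₁ c₂ =>
    let o := compileExpr R C ∅ l e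
    let br := nl
    let ex := nl + 1
    let o₁ := compileCode S R o.final none (nl + 2) c₁
    let o₂ := compileCode S R o.final (some br) o₁.next c₂
    ⟨o.code ++ [((if o.code.isEmpty then l else none, .jz br o.reg), o.final)] ++
        o₁.code ++ [((o₁.label, .jmp ex), o₁.final)] ++
        o₂.code ++ [((o₂.label, .nopEnd), o₂.final)],
      some ex, o₂.next, ⟨o₁.final.reg.meet o₂.final.reg, o₁.final.asm⟩,
      o.failed || o₁.failed || o₂.failed⟩
  | C, l, nl, .loop e c =>
    let lp := loopLabel l nl
    let ex := exitLabel l nl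
    let o := compileExpr R C.flush ∅ (some lp) e
    let o₁ := compileCode S R o.final none (ex + 1) c
    ⟨o.code ++ [((if o.code.isEmpty then some lp else none, .jz ex o.reg), o.final)] ++
        o₁.code ++ [((o₁.label, .jmp lp), o₁.final)],
      some ex, o₁.next, o.final, o.failed || o₁.failed⟩
  | C, l, nl, .lockAcq k =>
    ⟨[((l, .lockAcq k), C)], none, nl, ⟨C.reg, asmAcq S C.asm k⟩, false⟩
  | C, l, nl, .lockRel k =>
    ⟨[((l, .lockRel k), C)], none, nl,
      ⟨C.reg.keep (ExprStable S (asmRel S C.asm k)), asmRel S C.asm k⟩, false⟩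

/-- The compiler: it rejects inputs that violate the input requirements. -/
def compileCmd [Inhabited Reg] (S : LockSystem Val Var Lock) (R : RegAlloc Val Var Reg)
    (C : CompRec Val Var Lock Reg) (l : Option ℕ) (nl : ℕ) (c : Cmd Val Var Lock) :
    CmdOut Val Var Lock Reg :=
  let o := compileCode S R C l nl c
  { o with failed := open Classical in !decide (CompilerInputReqs S C l nl c) || o.failed }

/-! ### The refinement relation -/

/-- The registers, modes and memory are consistent with the record that annotates the
instruction at `pc`, and this record is stable. -/
def ConsistentAt (S : LockSystem Val Var Lock) (PCs : AText Val Var Lock Reg) (pc : ℕ)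
    (regs : Reg → Val) (mds : Mds Var Lock) (mem : Mem Val Var Lock) : Prop :=
  ∃ C, (PCs.map Prod.snd)[pc]? = some C ∧ CompiledCmdConfigConsistent C regs mds mem ∧
    RegrecStable S C

/-- A successful run of the compiler, with input requirements, on an assignment; `Pe` is the part
for the expression. -/
structure AssignRun [Inhabited Reg] (S : LockSystem Val Var Lock) (R : RegAlloc Val Var Reg)
    (C : CompRec Val Var Lock Reg) (l : Option ℕ) (nl : ℕ) (v : Var) (e : Expr Val Var)
    (PCs Pe : AText Val Var Lock Reg) : Prop where
  reqs : CompilerInputReqs S C l nl (.assign v e)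
  whole : ∃ l' nl' C', compileCmd S R C l nl (.assign v e) = ⟨PCs, l', nl', C', false⟩
  expr : ∃ r C₁, compileExpr R C ∅ l e = ⟨Pe, r, C₁, false⟩

/-- A successful run of the compiler, with input requirements, on a conditional; `Pe`, `P₁`, `P₂`
are the parts for the expression and the branches, `C₁` is the record after the expression. -/
structure IfRun [Inhabited Reg] (S : LockSystem Val Var Lock) (R : RegAlloc Val Var Reg)
    (C : CompRec Val Var Lock Reg) (l : Option ℕ) (nl : ℕ) (e : Expr Val Var)
    (c₁ c₂ : Cmd Val Var Lock) (PCs Pe : AText Val Var Lock Reg)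
    (C₁ : CompRec Val Var Lock Reg) (P₁ P₂ : AText Val Var Lock Reg) : Prop where
  reqs : CompilerInputReqs S C l nl (.ite e c₁ c₂)
  whole : ∃ l' nl' C', compileCmd S R C l nl (.ite e c₁ c₂) = ⟨PCs, l', nl', C', false⟩
  expr : ∃ r, compileExpr R C ∅ l e = ⟨Pe, r, C₁, false⟩
  branches : ∃ l₁ nl₁ C₂ l₂ nl₂ C₃,
    compileCmd S R C₁ none (nl + 2) c₁ = ⟨P₁, l₁, nl₁, C₂, false⟩ ∧
    compileCmd S R C₁ (some nl) nl₁ c₂ = ⟨P₂, l₂, nl₂, C₃, false⟩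

/-- A successful run of the compiler, with input requirements, on a loop; `Pe`, `Pb` are the parts
for the expression and the body, `C₁` is the record after the expression. -/
structure WhileRun [Inhabited Reg] (S : LockSystem Val Var Lock) (R : RegAlloc Val Var Reg)
    (C : CompRec Val Var Lock Reg) (l : Option ℕ) (nl : ℕ) (e : Expr Val Var)
    (c : Cmd Val Var Lock) (PCs Pe : AText Val Var Lock Reg)
    (C₁ : CompRec Val Var Lock Reg) (Pb : AText Val Var Lock Reg) : Prop where
  reqs : CompilerInputReqs S C l nl (.loop e c)
  whole : ∃ l' nl' C', compileCmd S R C l nl (.loop e c) = ⟨PCs, l', nl', C', false⟩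
  expr : ∃ r, compileExpr R C.flush ∅ (some (loopLabel l nl)) e = ⟨Pe, r, C₁, false⟩
  body : ∃ l₁ nl₁ C₂,
    compileCmd S R C₁ none (exitLabel l nl + 1) c = ⟨Pb, l₁, nl₁, C₂, false⟩

/-- The refinement relation between `While` and `RISC` configurations. -/
inductive RefRelWR [Zero Val] [Inhabited Reg] (S : LockSystem Val Var Lock)
    (R : RegAlloc Val Var Reg) :
    LocalConf (Cmd Val Var Lock) Val Var Lock →
      LocalConf (RiscState Val Var Lock Reg) Val Var Lock → Prop
  /-- Terminated programs. -/
  | halted (P regs mds mem) :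
      RefRelWR S R ⟨.halt, mds, mem⟩ ⟨⟨P.length, P, regs⟩, mds, mem⟩
  | skip_nop (l regs mds mem) :
      RefRelWR S R ⟨.skip, mds, mem⟩ ⟨⟨0, [(l, .nop)], regs⟩, mds, mem⟩
  /-- Evaluating the expression of an assignment. -/
  | assign_expr (C l nl v e PCs Pe pc regs mds mem) :
      AssignRun S R C l nl v e PCs Pe → pc < Pe.length →
      ConsistentAt S PCs pc regs mds mem →
      RefRelWR S R ⟨.assign v e, mds, mem⟩ ⟨⟨pc, PCs.map Prod.fst, regs⟩, mds, mem⟩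
  /-- At the final store of an assignment. -/
  | assign_store (C l nl v e PCs Pe regs mds mem) :
      AssignRun S R C l nl v e PCs Pe →
      (S.Governed v → VarStable S C.asm v) →
      ConsistentAt S PCs Pe.length regs mds mem →
      RefRelWR S R ⟨.assign v e, mds, mem⟩ ⟨⟨Pe.length, PCs.map Prod.fst, regs⟩, mds, mem⟩
  | lock_acq (l k regs mds mem) :
      RefRelWR S R ⟨.lockAcq k, mds, mem⟩ ⟨⟨0, [(l, .lockAcq k)], regs⟩, mds, mem⟩
  | lock_rel (l k regs mds mem) :
      RefRelWR S R ⟨.lockRel k, mds, mem⟩ ⟨⟨0, [(l, .lockRel k)], regs⟩, mds, mem⟩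
  /-- In the first part of a sequence compiled from `c₁; c₂`, where `c₁'` remains of `c₁`. -/
  | seq (C l nl c₁ PCs₁ l₁ nl₁ C₁ c₂ PCs₂ l₂ nl₂ C₂ c₁' pc regs mds mem) :
      CompilerInputReqs S C l nl c₁ →
      compileCmd S R C l nl c₁ = ⟨PCs₁, l₁, nl₁, C₁, false⟩ →
      CompilerInputReqs S C₁ l₁ nl₁ c₂ →
      compileCmd S R C₁ l₁ nl₁ c₂ = ⟨PCs₂, l₂, nl₂, C₂, false⟩ →
      Joinable (PCs₁.map Prod.fst) (PCs₂.map Prod.fst) →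
      CmdReach S c₁ c₁' → pc < PCs₁.length →
      ConsistentAt S PCs₁ pc regs mds mem →
      RefRelWR S R ⟨c₁', mds, mem⟩ ⟨⟨pc, PCs₁.map Prod.fst, regs⟩, mds, mem⟩ →
      (∀ regs' mds' mem', CompiledCmdConfigConsistent C₁ regs' mds' mem' → RegrecStable S C₁ →
        RefRelWR S R ⟨c₂, mds', mem'⟩ ⟨⟨0, PCs₂.map Prod.fst, regs'⟩, mds', mem'⟩) →
      RefRelWR S R ⟨seqCont c₁' c₂, mds, mem⟩
        ⟨⟨pc, PCs₁.map Prod.fst ++ PCs₂.map Prod.fst, regs⟩, mds, mem⟩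
  /-- In a text with an unreachable part `P₁` in front. -/
  | join (c P₁ P₂ pc regs mds mem) :
      Joinable P₁ P₂ → P₁.length ≤ pc →
      RefRelWR S R ⟨c, mds, mem⟩ ⟨⟨pc - P₁.length, P₂, regs⟩, mds, mem⟩ →
      RefRelWR S R ⟨c, mds, mem⟩ ⟨⟨pc, P₁ ++ P₂, regs⟩, mds, mem⟩
  /-- Evaluating the expression of a conditional, or at the jump that follows. -/
  | if_expr (C l nl e c₁ c₂ PCs Pe C₁ P₁ P₂ pc regs mds mem) :
      IfRun S R C l nl e c₁ c₂ PCs Pe C₁ P₁ P₂ → pc ≤ Pe.length →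
      ConsistentAt S PCs pc regs mds mem →
      (∀ regs' mds' mem', CompiledCmdConfigConsistent C₁ regs' mds' mem' → RegrecStable S C₁ →
        RefRelWR S R ⟨c₁, mds', mem'⟩ ⟨⟨0, P₁.map Prod.fst, regs'⟩, mds', mem'⟩) →
      (∀ regs' mds' mem', CompiledCmdConfigConsistent C₁ regs' mds' mem' → RegrecStable S C₁ →
        RefRelWR S R ⟨c₂, mds', mem'⟩ ⟨⟨0, P₂.map Prod.fst, regs'⟩, mds', mem'⟩) →
      RefRelWR S R ⟨.ite e c₁ c₂, mds, mem⟩ ⟨⟨pc, PCs.map Prod.fst, regs⟩, mds, mem⟩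
  /-- In the "then" branch. -/
  | if_c1 (C l nl e c₁ c₂ PCs Pe C₁ P₁ P₂ c₁' pc regs mds mem) :
      IfRun S R C l nl e c₁ c₂ PCs Pe C₁ P₁ P₂ → CmdReach S c₁ c₁' → pc < P₁.length →
      ConsistentAt S PCs (Pe.length + 1 + pc) regs mds mem →
      RefRelWR S R ⟨c₁', mds, mem⟩ ⟨⟨pc, P₁.map Prod.fst, regs⟩, mds, mem⟩ →
      RefRelWR S R ⟨c₁', mds, mem⟩
        ⟨⟨Pe.length + 1 + pc, PCs.map Prod.fst, regs⟩, mds, mem⟩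
  /-- In the "else" branch. -/
  | if_c2 (C l nl e c₁ c₂ PCs Pe C₁ P₁ P₂ c₂' pc regs mds mem) :
      IfRun S R C l nl e c₁ c₂ PCs Pe C₁ P₁ P₂ → CmdReach S c₂ c₂' → pc < P₂.length →
      ConsistentAt S PCs (Pe.length + 1 + P₁.length + 1 + pc) regs mds mem →
      RefRelWR S R ⟨c₂', mds, mem⟩ ⟨⟨pc, P₂.map Prod.fst, regs⟩, mds, mem⟩ →
      RefRelWR S R ⟨c₂', mds, mem⟩
        ⟨⟨Pe.length + 1 + P₁.length + 1 + pc, PCs.map Prod.fst, regs⟩, mds, mem⟩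
  /-- A terminated `While` program stands still while the `RISC` program takes a silent control
  flow step. -/
  | epilogue_step (P pc lb i regs mds mem) :
      P[pc]? = some (lb, i) → ((∃ l, i = .jmp l) ∨ i = .nopEnd) →
      (∀ b, RiscStep S ⟨⟨pc, P, regs⟩, mds, mem⟩ b → RefRelWR S R ⟨.halt, mds, mem⟩ b) →
      RefRelWR S R ⟨.halt, mds, mem⟩ ⟨⟨pc, P, regs⟩, mds, mem⟩
  /-- Evaluating the expression of a loop, or at the jump that follows. The first step of the
  loop, to a conditional, goes along with the first instruction. -/
  | while_expr (C l nl e c PCs Pe C₁ Pb w pc regs mds mem) :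
      WhileRun S R C l nl e c PCs Pe C₁ Pb → pc ≤ Pe.length →
      w = (if pc = 0 then .loop e c else .ite e (.seq c (.loop e c)) .halt) →
      ConsistentAt S PCs pc regs mds mem →
      (∀ regs' mds' mem', CompiledCmdConfigConsistent C₁ regs' mds' mem' → RegrecStable S C₁ →
        RefRelWR S R ⟨c, mds', mem'⟩ ⟨⟨0, Pb.map Prod.fst, regs'⟩, mds', mem'⟩) →
      RefRelWR S R ⟨w, mds, mem⟩ ⟨⟨pc, PCs.map Prod.fst, regs⟩, mds, mem⟩
  /-- In the body of a loop, where `cI` remains of the body. -/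
  | while_inner (C l nl e c PCs Pe C₁ Pb cI pc regs mds mem) :
      WhileRun S R C l nl e c PCs Pe C₁ Pb → CmdReach S c cI → cI ≠ .halt → pc < Pb.length →
      ConsistentAt S PCs (Pe.length + 1 + pc) regs mds mem →
      RefRelWR S R ⟨cI, mds, mem⟩ ⟨⟨pc, Pb.map Prod.fst, regs⟩, mds, mem⟩ →
      (∀ regs' mds' mem', CompiledCmdConfigConsistent C₁ regs' mds' mem' → RegrecStable S C₁ →
        RefRelWR S R ⟨c, mds', mem'⟩ ⟨⟨0, Pb.map Prod.fst, regs'⟩, mds', mem'⟩) →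
      RefRelWR S R ⟨.seq cI (.loop e c), mds, mem⟩
        ⟨⟨Pe.length + 1 + pc, PCs.map Prod.fst, regs⟩, mds, mem⟩
  /-- In the epilogue steps of the body of a loop, or at the jump back to the head. -/
  | while_loop (C l nl e c PCs Pe C₁ Pb pc regs mds mem) :
      WhileRun S R C l nl e c PCs Pe C₁ Pb → pc ≤ Pb.length →
      ConsistentAt S PCs (Pe.length + 1 + pc) regs mds mem →
      RefRelWR S R ⟨.halt, mds, mem⟩ ⟨⟨pc, Pb.map Prod.fst, regs⟩, mds, mem⟩ →
      (∀ regs' mds' mem', CompiledCmdConfigConsistent C₁ regs' mds' mem' → RegrecStable S C₁ →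
        RefRelWR S R ⟨c, mds', mem'⟩ ⟨⟨0, Pb.map Prod.fst, regs'⟩, mds', mem'⟩) →
      RefRelWR S R ⟨.loop e c, mds, mem⟩
        ⟨⟨Pe.length + 1 + pc, PCs.map Prod.fst, regs⟩, mds, mem⟩

end Compiler

end

section Compilation

variable {Val : Type u₁} {Var : Type u₂} {Lock : Type u₃} {Reg : Type u₄}

/-! ### Stability of records -/

/-! The proof is a structural induction on `c`. At `pc = 0` only the rules of `RefRelWR` that
describe the entry of a compiled command are needed. For composite commands these rules ask that the
components be related under every consistent state. This is the induction hypothesis, provided that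
record, labels, registers, modes and memory are all generalized. A loop needs no fixed-point
argument: `while_expr` asks only that the body be related from its start, not that further
iterations be.

What remains is to verify the side conditions, which concern labels and records.

Labels: code emitted with next fresh label `nl` carries, besides its initial label, only labels from
the half-open interval from `nl` to the next fresh label it returns, so consecutive runs draw on
disjoint intervals. The code is also nonempty, and each jump targets a label inside it or the label
owed to its successor. `compileCode_layout` maintains this invariant; `CodeLayout.joinable` and
`CodeLayout.consistentAt_zero` are read off from it.

Records: `compileExpr_final_asm` and `compileCode_final_asm` show that the compiler carries
assumptions along exactly as the stability checks do, and `compileExpr_final_stable` and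
`compileCode_final_stable` show that register records remain stable. Hence the input requirements on
a command pass to its parts. -/

theorem VarStable.mono {S : LockSystem Val Var Lock} {A B : AsmRec Var Lock} {v : Var}
    (hAB : A.1 ∪ A.2 ⊆ B.1 ∪ B.2) (h : VarStable S A v) : VarStable S B v :=
  ⟨hAB h.1, fun v' hv' => hAB (h.2 v' hv')⟩

/-- This is why compiling an acquisition may keep the whole register record: assumptions only grow,
so nothing stable becomes unstable. -/
theorem union_subset_asmAcq (S : LockSystem Val Var Lock) (A : AsmRec Var Lock) (k : Lock) :
    A.1 ∪ A.2 ⊆ (asmAcq S A k).1 ∪ (asmAcq S A k).2 :=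
  Set.union_subset_union Set.subset_union_left Set.subset_union_left

theorem RegrecStable.record {S : LockSystem Val Var Lock} {C : CompRec Val Var Lock Reg}
    {r : Reg} {e : Expr Val Var} (h : RegrecStable S C) (he : ExprStable S C.asm e) :
    RegrecStable S (C.record r e) := by
  intro r' e' hr'
  by_cases hrr : r' = r
  · subst hrr
    simp only [CompRec.record, Function.update_self, Option.some.injEq] at hr'
    subst hr'
    exact he
  · simp only [CompRec.record, ne_eq, hrr, not_false_eq_true, Function.update_of_ne] at hr'
    exact h r' e' hr'

theorem RegrecStable.flush (S : LockSystem Val Var Lock) (C : CompRec Val Var Lock Reg) :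
    RegrecStable S C.flush := by
  intro r e h
  simp [CompRec.flush] at h

theorem RegRec.keep_eq_some {Φ : RegRec Val Var Reg} {p : Expr Val Var → Prop} {r : Reg}
    {e : Expr Val Var} : Φ.keep p r = some e ↔ Φ r = some e ∧ p e := by
  simp [RegRec.keep, Option.filter_eq_some_iff]

/-- One side suffices: a conditional takes its final assumptions from the first branch, so stability
of the merged record is inherited from there. -/
theorem RegRec.meet_eq_some {Φ Φ' : RegRec Val Var Reg} {r : Reg} {e : Expr Val Var}
    (h : Φ.meet Φ' r = some e) : Φ r = some e := by
  unfold RegRec.meet at h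
  split_ifs at h
  exact h

/-! ### Layout of compiled code -/

/-- Layout of the code emitted for a command, given the initial record, the initial label and the
next fresh label. -/
structure CodeLayout (C : CompRec Val Var Lock Reg) (l : Option ℕ) (nl : ℕ)
    (o : CmdOut Val Var Lock Reg) : Prop where
  /-- The initial label, if present, is on the first instruction. -/
  head : ∃ p t, o.code = p :: t ∧ (∀ x, l = some x → p.1.1 = some x) ∧
    (p.2 = C ∨ p.2 = C.flush)
  next_le : nl ≤ o.next
  owed_fresh : ∀ x, o.label = some x → nl ≤ x ∧ x < o.next ∧ ∀ p ∈ o.code, p.1.1 ≠ some x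
  label_mem : ∀ p ∈ o.code, ∀ x, p.1.1 = some x → l = some x ∨ nl ≤ x ∧ x < o.next
  jump_mem : ∀ p ∈ o.code, ∀ x, p.1.2.target = some x →
    o.label = some x ∨ ∃ q ∈ o.code, q.1.1 = some x

theorem codeLayout_singleton (C C' : CompRec Val Var Lock Reg) (l : Option ℕ) (nl : ℕ)
    {i : Instr Val Var Lock Reg} (hi : i.target = none) :
    CodeLayout C l nl ⟨[((l, i), C)], none, nl, C', false⟩ where
  head := ⟨_, _, rfl, fun _ h => h, Or.inl rfl⟩
  next_le := le_rfl
  owed_fresh := by simp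
  label_mem := by simp +contextual
  jump_mem := by simp [hi]

/-- The label owed by the first part lies on the first instruction of the second, which exists
because code is nonempty; so the pending jumps of the first part become internal. Labels of the
second part are this owed label or at least `o₁.next`, while `l < nl` keeps the initial label apart
from everything fresh. -/
theorem CodeLayout.seq {C C₁ : CompRec Val Var Lock Reg} {l : Option ℕ} {nl : ℕ}
    {o₁ o₂ : CmdOut Val Var Lock Reg} {b : Bool} (hl : ∀ x, l = some x → x < nl)
    (h₁ : CodeLayout C l nl o₁) (h₂ : CodeLayout C₁ o₁.label o₁.next o₂) :
    CodeLayout C l nl ⟨o₁.code ++ o₂.code, o₂.label, o₂.next, o₂.final, b⟩ := by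
  obtain ⟨⟨p₁, t₁, e₁, hp₁, hC₁⟩, n₁, f₁, m₁, j₁⟩ := h₁
  obtain ⟨⟨p₂, t₂, e₂, hp₂, hC₂⟩, n₂, f₂, m₂, j₂⟩ := h₂
  have hmem : p₂ ∈ o₂.code := by simp [e₂]
  refine ⟨⟨p₁, t₁ ++ o₂.code, by simp [e₁], hp₁, hC₁⟩, n₁.trans n₂, ?_, ?_, ?_⟩
  all_goals simp only [List.mem_append]
  · grind
  · grind
  · grind

/-- Forward, a jump that leaves the first text goes to its owed label, which heads the second.
Backward, a target of the second text is either that owed label, which is absent from the first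
text, or at least `o₁.next`, which exceeds all labels there. -/
theorem CodeLayout.joinable {C C₁ : CompRec Val Var Lock Reg} {l : Option ℕ} {nl : ℕ}
    {o₁ o₂ : CmdOut Val Var Lock Reg} (hl : ∀ x, l = some x → x < nl)
    (h₁ : CodeLayout C l nl o₁) (h₂ : CodeLayout C₁ o₁.label o₁.next o₂) :
    Joinable (o₁.code.map Prod.fst) (o₂.code.map Prod.fst) := by
  obtain ⟨-, n₁, f₁, m₁, j₁⟩ := h₁
  obtain ⟨⟨p₂, t₂, e₂, hp₂, hC₂⟩, n₂, f₂, m₂, j₂⟩ := h₂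
  constructor
  · rintro x ⟨i, hi, hx⟩
    obtain ⟨p, hp, rfl⟩ := List.mem_map.1 hi
    obtain h | ⟨q, hq, h⟩ := j₁ p hp x hx
    · exact Or.inr ⟨p₂.1, by simp [e₂], hp₂ x h⟩
    · exact Or.inl ⟨q.1, List.mem_map_of_mem hq, h⟩
  · rintro x ⟨i, hi, hx⟩ ⟨i', hi', hx'⟩
    obtain ⟨p, hp, rfl⟩ := List.mem_map.1 hi
    obtain ⟨q, hq, rfl⟩ := List.mem_map.1 hi'
    grind

/-- At the entry of compiled code the annotation is stable and consistent if the initial record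
is. -/
theorem CodeLayout.consistentAt_zero {S : LockSystem Val Var Lock} {C : CompRec Val Var Lock Reg}
    {l : Option ℕ} {nl : ℕ} {o : CmdOut Val Var Lock Reg} (h : CodeLayout C l nl o)
    (hC : RegrecStable S C) {regs : Reg → Val} {mds : Mds Var Lock} {mem : Mem Val Var Lock}
    (hc : CompiledCmdConfigConsistent C regs mds mem) :
    ConsistentAt S o.code 0 regs mds mem := by
  obtain ⟨p, t, ht, -, hp | hp⟩ := h.head
  · exact ⟨C, by simp [ht, hp], hc, hC⟩
  -- The case of a loop: the emptied register record is consistent with any registers, and flushing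
  -- leaves the assumptions alone.
  · exact ⟨C.flush, by simp [ht, hp], ⟨by simp [RegrecMemConsistent, CompRec.flush], hc.2⟩,
      RegrecStable.flush S C⟩

/-! ### Output of the expression compiler -/

variable [Inhabited Reg]

/-- The first instruction emitted, if there is one, carries the initial label and is annotated
with the initial record; otherwise the record does not change. -/
theorem compileExpr_head (R : RegAlloc Val Var Reg) (e : Expr Val Var) :
    ∀ (C : CompRec Val Var Lock Reg) (A : Set Reg) (l : Option ℕ),
      ((compileExpr R C A l e).code = [] ∧ (compileExpr R C A l e).final = C) ∨
      ∃ i t, (compileExpr R C A l e).code = ((l, i), C) :: t := by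
  induction e with
  | const n =>
    intro C A l
    simp only [compileExpr]
    cases R.alloc C.reg A <;> simp
  | var v =>
    intro C A l
    simp only [compileExpr]
    cases R.allocCached C.reg A v <;> cases R.alloc C.reg A <;> simp
  | op f e₁ e₂ ih₁ ih₂ =>
    intro C A l
    -- An operation always emits its own instruction; the cases below differ in which part emits the
    -- first one.
    refine Or.inr ?_
    simp only [compileExpr]
    generalize ho₁ : compileExpr R C A l e₁ = o₁
    obtain ⟨h₁, hC₁⟩ | ⟨i, t, h₁⟩ := ho₁ ▸ ih₁ C A l
    · generalize ho₂ : compileExpr R o₁.final (insert o₁.reg A)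
        (if o₁.code.isEmpty then l else none) e₂ = o₂
      obtain ⟨h₂, hC₂⟩ | ⟨i, t, h₂⟩ := ho₂ ▸ ih₂ o₁.final (insert o₁.reg A)
        (if o₁.code.isEmpty then l else none)
      -- Neither operand emits code, so the initial label has been passed down to the `op`
      -- instruction and the record is still `C`.
      · simp [h₁, h₂, hC₁, hC₂]
      · simp [h₁, h₂, hC₁]
    · simp [h₁]

/-- The code of an expression carries no label but the initial one, and it does not jump. -/
theorem compileExpr_labels (R : RegAlloc Val Var Reg) (e : Expr Val Var) :
    ∀ (C : CompRec Val Var Lock Reg) (A : Set Reg) (l : Option ℕ),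
      ∀ p ∈ (compileExpr R C A l e).code,
        (∀ x, p.1.1 = some x → l = some x) ∧ p.1.2.target = none := by
  induction e with
  | const n =>
    intro C A l
    simp only [compileExpr]
    cases R.alloc C.reg A <;> simp [Instr.target]
  | var v =>
    intro C A l
    simp only [compileExpr]
    cases R.allocCached C.reg A v <;> cases R.alloc C.reg A <;> simp [Instr.target]
  | op f e₁ e₂ ih₁ ih₂ =>
    intro C A l p hp
    simp only [compileExpr, List.mem_append, List.mem_singleton] at hp
    rcases hp with (hp | hp) | rfl
    · exact ih₁ _ _ _ p hp
    · refine ⟨fun x hx => ?_, (ih₂ _ _ _ p hp).2⟩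
      have := (ih₂ _ _ _ p hp).1 x hx
      split_ifs at this
      exact this
    · refine ⟨fun x hx => ?_, rfl⟩
      dsimp only at hx
      split_ifs at hx
      exact hx

/-- Evaluation touches registers only. Hence checks stated for the assumptions before a guard apply
to the branches or body compiled after it. -/
theorem compileExpr_final_asm (R : RegAlloc Val Var Reg) (e : Expr Val Var) :
    ∀ (C : CompRec Val Var Lock Reg) (A : Set Reg) (l : Option ℕ),
      (compileExpr R C A l e).final.asm = C.asm := by
  induction e with
  | const n =>
    intro C A l
    simp only [compileExpr]
    cases R.alloc C.reg A <;> rfl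
  | var v =>
    intro C A l
    simp only [compileExpr]
    cases R.allocCached C.reg A v <;> cases R.alloc C.reg A <;> rfl
  | op f e₁ e₂ ih₁ ih₂ =>
    intro C A l
    simp only [compileExpr, CompRec.record, ih₁, ih₂]

/-- Every entry added is a subexpression of `e`, and the assumptions against which it is judged do
not change. -/
theorem compileExpr_final_stable {S : LockSystem Val Var Lock} (R : RegAlloc Val Var Reg)
    (e : Expr Val Var) :
    ∀ (C : CompRec Val Var Lock Reg) (A : Set Reg) (l : Option ℕ),
      RegrecStable S C → ExprStable S C.asm e →
        RegrecStable S (compileExpr R C A l e).final := by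
  induction e with
  | const n =>
    intro C A l hC he
    simp only [compileExpr]
    cases R.alloc C.reg A
    · exact hC
    · exact hC.record he
  | var v =>
    intro C A l hC he
    simp only [compileExpr]
    cases R.allocCached C.reg A v
    · cases R.alloc C.reg A
      · exact hC
      · exact hC.record he
    · exact hC
  | op f e₁ e₂ ih₁ ih₂ =>
    intro C A l hC he
    refine RegrecStable.record (ih₂ _ _ _ (ih₁ _ _ _ hC fun v hv => he v (Or.inl hv)) ?_) ?_
    · rw [compileExpr_final_asm]
      exact fun v hv => he v (Or.inr hv)
    · rw [compileExpr_final_asm, compileExpr_final_asm]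
      exact he

/-- The code of an expression followed by one more instruction starts with the initial label and
the initial record. -/
theorem compileExpr_append_head (R : RegAlloc Val Var Reg) (C : CompRec Val Var Lock Reg)
    (A : Set Reg) (l : Option ℕ) (e : Expr Val Var) (i : Instr Val Var Lock Reg)
    (t : AText Val Var Lock Reg) :
    ∃ j t', (compileExpr R C A l e).code ++
      ((if (compileExpr R C A l e).code.isEmpty then l else none, i),
        (compileExpr R C A l e).final) :: t = ((l, j), C) :: t' := by
  obtain ⟨h, hC⟩ | ⟨j, t', h⟩ := compileExpr_head R e C A l
  · simp [h, hC]
  · simp [h]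

/-! ### Output of the command compiler -/

/-- Success matters because `halt` emits nothing, which would leave an owed label without an
instruction. In a conditional or loop, the parts get fresh labels above those reserved for the
construct itself, and the exit label is the one owed. -/
theorem compileCode_layout (S : LockSystem Val Var Lock) (R : RegAlloc Val Var Reg)
    (c : Cmd Val Var Lock) :
    ∀ (C : CompRec Val Var Lock Reg) (l : Option ℕ) (nl : ℕ), (∀ x, l = some x → x < nl) →
      (compileCode S R C l nl c).failed = false →
        CodeLayout C l nl (compileCode S R C l nl c) := by
  induction c with
  | halt => intro C l nl _ hf; simp [compileCode] at hf
  | skip => intro C l nl _ _; exact codeLayout_singleton C _ l nl rfl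
  | lockAcq k => intro C l nl _ _; exact codeLayout_singleton C _ l nl rfl
  | lockRel k => intro C l nl _ _; exact codeLayout_singleton C _ l nl rfl
  | assign v e =>
    intro C l nl _ _
    have hlab := compileExpr_labels R e C ∅ l
    obtain ⟨j, t, ht⟩ := compileExpr_append_head R C ∅ l e
      (.store v (compileExpr R C ∅ l e).reg) []
    refine ⟨⟨_, _, ht, fun _ h => h, Or.inl rfl⟩, le_rfl, by simp [compileCode], ?_, ?_⟩
    all_goals
      simp only [compileCode, List.mem_append, List.mem_singleton]
    · grind
    · rintro p (hp | rfl) x hx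
      · simp [(hlab p hp).2] at hx
      · simp [Instr.target] at hx
  | seq c₁ c₂ ih₁ ih₂ =>
    intro C l nl hl hf
    simp only [compileCode, Bool.or_eq_false_iff] at hf
    have h₁ := ih₁ C l nl hl hf.1
    exact h₁.seq hl (ih₂ _ _ _ (fun x hx => (h₁.owed_fresh x hx).2.1) hf.2)
  | ite e c₁ c₂ ih₁ ih₂ =>
    intro C l nl hl hf
    have hlab := compileExpr_labels R e C ∅ l
    simp only [compileCode, Bool.or_eq_false_iff] at hf ⊢
    have h₁ := ih₁ (compileExpr R C ∅ l e).final none (nl + 2) (by simp) hf.1.2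
    have hnl := h₁.next_le
    -- The initial label `nl` of the else branch is below its fresh counter, since the then branch
    -- started at `nl + 2`.
    have h₂ := ih₂ _ _ _ (by grind) hf.2
    have hhead := compileExpr_append_head R C ∅ l e
      (.jz nl (compileExpr R C ∅ l e).reg)
    generalize compileExpr R C ∅ l e = o at *
    generalize compileCode S R o.final none (nl + 2) c₁ = o₁ at *
    generalize compileCode S R o.final (some nl) o₁.next c₂ = o₂ at *
    obtain ⟨-, n₁, f₁, m₁, j₁⟩ := h₁
    obtain ⟨⟨p₂, t₂, e₂, hp₂, -⟩, n₂, f₂, m₂, j₂⟩ := h₂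
    -- This instruction carries the label `nl` and is therefore the target of the `jz`.
    have hmem : p₂ ∈ o₂.code := by simp [e₂]
    obtain ⟨j, t, ht⟩ := hhead
      (o₁.code ++ [((o₁.label, .jmp (nl + 1)), o₁.final)] ++
        o₂.code ++ [((o₂.label, .nopEnd), o₂.final)])
    refine ⟨⟨_, _, by simpa using ht, fun _ h => h, Or.inl rfl⟩, by grind, ?_, ?_, ?_⟩
    all_goals simp only [List.mem_append, List.mem_singleton]
    · grind
    · grind
    · rintro p (((((hp | rfl) | hp) | rfl) | hp) | rfl) x hx
      · simp [(hlab p hp).2] at hx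
      · grind [Instr.target]
      · grind
      · grind [Instr.target]
      · grind
      · simp [Instr.target] at hx
  | loop e c ih =>
    intro C l nl hl hf
    simp only [compileCode, Bool.or_eq_false_iff] at hf ⊢
    -- All that is used about the two labels: the head label is the initial one or the first fresh
    -- one, and the exit label is fresh and strictly above it.
    have hlp : (∀ x, l = some x → loopLabel l nl = x) ∧
        (l = some (loopLabel l nl) ∨ loopLabel l nl = nl ∧ exitLabel l nl = nl + 1) ∧
        nl ≤ exitLabel l nl ∧ loopLabel l nl < exitLabel l nl := by
      cases l <;> grind [loopLabel, exitLabel]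
    generalize loopLabel l nl = lp at *
    generalize exitLabel l nl = ex at *
    have hlab := compileExpr_labels R e C.flush ∅ (some lp)
    have h₁ := ih (compileExpr R C.flush ∅ (some lp) e).final none (ex + 1) (by simp) hf.2
    have hhead := compileExpr_append_head R C.flush ∅ (some lp) e
      (.jz ex (compileExpr R C.flush ∅ (some lp) e).reg)
    generalize compileExpr R C.flush ∅ (some lp) e = o at *
    generalize compileCode S R o.final none (ex + 1) c = o₁ at *
    obtain ⟨-, n₁, f₁, m₁, j₁⟩ := h₁
    obtain ⟨j, t, ht⟩ := hhead (o₁.code ++ [((o₁.label, .jmp lp), o₁.final)])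
    refine ⟨⟨_, _, by simpa using ht, by grind, Or.inr rfl⟩, by grind, ?_, ?_, ?_⟩
    · simp only [List.mem_append, List.mem_singleton]
      grind
    · simp only [List.mem_append, List.mem_singleton]
      grind
    · have hhd : ∃ q ∈ o.code ++ [((if o.code.isEmpty then some lp else none, .jz ex o.reg),
          o.final)] ++ o₁.code ++ [((o₁.label, .jmp lp), o₁.final)], q.1.1 = some lp :=
        ⟨((some lp, j), C.flush), by
          rw [List.append_assoc, List.append_assoc, List.singleton_append, ht]; simp, rfl⟩
      intro p hp x hx
      simp only [List.mem_append, List.mem_singleton] at hp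
      rcases hp with ((hp | rfl) | hp) | rfl
      · simp [(hlab p hp).2] at hx
      · exact Or.inl hx
      -- A label owed by the body is carried by the closing `jmp`.
      · refine Or.inr ?_
        obtain h | ⟨q, hq, h⟩ := j₁ p hp x hx
        · exact ⟨((o₁.label, .jmp lp), o₁.final), by simp, h⟩
        · exact ⟨q, by simp [hq], h⟩
      · obtain rfl : lp = x := by simpa [Instr.target] using hx
        exact Or.inr hhd

/-- Compiler and stability checks follow the same conventions: a conditional ends with the
assumptions of its first branch, a loop with those on entry. So the check on the second part of a
sequence is a check on the record with which it is compiled. -/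
theorem compileCode_final_asm (S : LockSystem Val Var Lock) (R : RegAlloc Val Var Reg)
    (c : Cmd Val Var Lock) :
    ∀ (C : CompRec Val Var Lock Reg) (l : Option ℕ) (nl : ℕ),
      (compileCode S R C l nl c).final.asm = asmAfter S c C.asm := by
  induction c with
  | seq c₁ c₂ ih₁ ih₂ =>
    intro C l nl
    simp only [compileCode, asmAfter, ih₁, ih₂]
  | ite e c₁ c₂ ih₁ ih₂ =>
    intro C l nl
    simp only [compileCode, asmAfter, ih₁, compileExpr_final_asm]
  | loop e c ih =>
    intro C l nl
    simp only [compileCode, asmAfter, compileExpr_final_asm, CompRec.flush]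
  | assign v e =>
    intro C l nl
    simp only [compileCode, asmAfter, compileExpr_final_asm]
  | _ => intro C l nl; rfl

/-- Acquiring enlarges the assumptions, releasing filters by the reduced ones, assigning only drops
entries, and a loop ends with the record of its guard, built from the empty one. This supplies the
input requirements for the second part of a sequence. -/
theorem compileCode_final_stable (S : LockSystem Val Var Lock) (R : RegAlloc Val Var Reg)
    (c : Cmd Val Var Lock) :
    ∀ (C : CompRec Val Var Lock Reg) (l : Option ℕ) (nl : ℕ), RegrecStable S C →
      StabilityChecks S c C → RegrecStable S (compileCode S R C l nl c).final := by
  induction c with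
  | halt => intro C l nl hC _; exact hC
  | skip => intro C l nl hC _; exact hC
  | lockAcq k =>
    intro C l nl hC _ r e hr v hv
    exact (hC r e hr v hv).mono (union_subset_asmAcq S C.asm k)
  | lockRel k =>
    intro C l nl hC _ r e hr
    exact (RegRec.keep_eq_some.1 hr).2
  | assign v e =>
    intro C l nl hC hs r e' hr
    exact compileExpr_final_stable R e C ∅ l hC hs.1 r e' (RegRec.keep_eq_some.1 hr).1
  | seq c₁ c₂ ih₁ ih₂ =>
    intro C l nl hC hs
    refine ih₂ _ _ _ (ih₁ _ _ _ hC hs.1) ?_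
    rw [StabilityChecks, compileCode_final_asm]
    exact hs.2
  | ite e c₁ c₂ ih₁ ih₂ =>
    intro C l nl hC hs r e' hr
    refine ih₁ (compileExpr R C ∅ l e).final none (nl + 2)
      (compileExpr_final_stable R e C ∅ l hC hs.1) ?_ r e' (RegRec.meet_eq_some hr)
    rw [StabilityChecks, compileExpr_final_asm]
    exact hs.2.1
  | loop e c ih =>
    intro C l nl hC hs
    exact compileExpr_final_stable R e C.flush ∅ _ (RegrecStable.flush S C) hs.1

/-! ### Successful runs and the refinement induction -/

theorem ne_halt_of_compileCode {S : LockSystem Val Var Lock} {R : RegAlloc Val Var Reg}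
    {C : CompRec Val Var Lock Reg} {l : Option ℕ} {nl : ℕ} {c : Cmd Val Var Lock}
    (h : (compileCode S R C l nl c).failed = false) : c ≠ .halt := by
  rintro rfl
  simp [compileCode] at h

/-- The rules of `RefRelWR` speak of the checked compiler, whereas the recursion runs through
`compileCode`; under the input requirements the two agree. -/
theorem compileCmd_eq {S : LockSystem Val Var Lock} {R : RegAlloc Val Var Reg}
    {C : CompRec Val Var Lock Reg} {l : Option ℕ} {nl : ℕ} {c : Cmd Val Var Lock}
    (hr : CompilerInputReqs S C l nl c) (hf : (compileCode S R C l nl c).failed = false) :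
    compileCmd S R C l nl c = ⟨(compileCode S R C l nl c).code, (compileCode S R C l nl c).label,
      (compileCode S R C l nl c).next, (compileCode S R C l nl c).final, false⟩ := by
  simp [compileCmd, hr, hf]

theorem compileExpr_eq {R : RegAlloc Val Var Reg} {C : CompRec Val Var Lock Reg} {A : Set Reg}
    {l : Option ℕ} {e : Expr Val Var} (hf : (compileExpr R C A l e).failed = false) :
    compileExpr R C A l e = ⟨(compileExpr R C A l e).code, (compileExpr R C A l e).reg,
      (compileExpr R C A l e).final, false⟩ := by
  rw [← hf]

/-- Successful compilations are refinements. -/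
theorem refRelWR_compileCode [Zero Val] (S : LockSystem Val Var Lock) (R : RegAlloc Val Var Reg)
    (c : Cmd Val Var Lock) :
    ∀ (C : CompRec Val Var Lock Reg) (l : Option ℕ) (nl : ℕ), CompilerInputReqs S C l nl c →
      (compileCode S R C l nl c).failed = false →
      ∀ (regs : Reg → Val) (mds : Mds Var Lock) (mem : Mem Val Var Lock),
        CompiledCmdConfigConsistent C regs mds mem →
        RefRelWR S R ⟨c, mds, mem⟩
          ⟨⟨0, (compileCode S R C l nl c).code.map Prod.fst, regs⟩, mds, mem⟩ := by
  induction c with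
  | halt => intro C l nl hr; exact absurd rfl hr.2.2.1
  | skip => intro C l nl _ _ regs mds mem _; exact .skip_nop l regs mds mem
  | lockAcq k => intro C l nl _ _ regs mds mem _; exact .lock_acq l k regs mds mem
  | lockRel k => intro C l nl _ _ regs mds mem _; exact .lock_rel l k regs mds mem
  | assign v e =>
    intro C l nl hr hf regs mds mem hc
    have hcons := (compileCode_layout S R (.assign v e) C l nl hr.2.2.2 hf).consistentAt_zero
      hr.2.1 hc
    have hrun : AssignRun S R C l nl v e _ _ :=
      ⟨hr, ⟨_, _, _, compileCmd_eq hr hf⟩, ⟨_, _, compileExpr_eq hf⟩⟩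
    -- If the value is already cached, the expression emits no code and position `0` is the store
    -- itself.
    rcases Nat.eq_zero_or_pos (compileExpr R C ∅ l e).code.length with h0 | h0
    · have := RefRelWR.assign_store C l nl v e _ _ regs mds mem hrun
        (fun hg => by_contra fun hv => hr.1.2 hv hg) (h0.symm ▸ hcons)
      rwa [h0] at this
    · exact .assign_expr C l nl v e _ _ 0 regs mds mem hrun h0 hcons
  | seq c₁ c₂ ih₁ ih₂ =>
    intro C l nl hr hf regs mds mem hc
    simp only [compileCode, Bool.or_eq_false_iff] at hf
    have hne₁ := ne_halt_of_compileCode hf.1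
    have hr₁ : CompilerInputReqs S C l nl c₁ := ⟨hr.1.1, hr.2.1, hne₁, hr.2.2.2⟩
    have h₁ := compileCode_layout S R c₁ C l nl hr.2.2.2 hf.1
    have hr₂ : CompilerInputReqs S (compileCode S R C l nl c₁).final
        (compileCode S R C l nl c₁).label (compileCode S R C l nl c₁).next c₂ := by
      refine ⟨?_, compileCode_final_stable S R c₁ C l nl hr.2.1 hr.1.1,
        ne_halt_of_compileCode hf.2, fun x hx => (h₁.owed_fresh x hx).2.1⟩
      rw [StabilityChecks, compileCode_final_asm]
      exact hr.1.2
    have h₂ := compileCode_layout S R c₂ _ _ _ hr₂.2.2.2 hf.2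
    have hlen : 0 < (compileCode S R C l nl c₁).code.length := by
      obtain ⟨p, t, ht, -⟩ := h₁.head
      simp [ht]
    -- `seqCont` would collapse only for `c₁ = .halt`, which a successful run excludes.
    have hseq : seqCont c₁ c₂ = .seq c₁ c₂ := by cases c₁ <;> first | rfl | exact absurd rfl hne₁
    -- At the entry all of `c₁` remains, so reachability is reflexive.
    have := RefRelWR.seq (R := R) C l nl c₁ _ _ _ _ c₂ _ _ _ _ c₁ 0 regs mds mem hr₁
      (compileCmd_eq hr₁ hf.1) hr₂ (compileCmd_eq hr₂ hf.2) (h₁.joinable hr.2.2.2 h₂) .refl hlen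
      (h₁.consistentAt_zero hr.2.1 hc) (ih₁ C l nl hr₁ hf.1 regs mds mem hc)
      (fun regs' mds' mem' hc' _ => ih₂ _ _ _ hr₂ hf.2 regs' mds' mem' hc')
    rw [hseq] at this
    simpa [compileCode] using this
  | ite e c₁ c₂ ih₁ ih₂ =>
    intro C l nl hr hf regs mds mem hc
    have hcons := (compileCode_layout S R (.ite e c₁ c₂) C l nl hr.2.2.2 hf).consistentAt_zero
      hr.2.1 hc
    have hwhole := compileCmd_eq hr hf
    simp only [compileCode, Bool.or_eq_false_iff] at hf
    have hst := compileExpr_final_stable R e C ∅ l hr.2.1 hr.1.1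
    have hr₁ : CompilerInputReqs S (compileExpr R C ∅ l e).final none (nl + 2) c₁ := by
      refine ⟨?_, hst, ne_halt_of_compileCode hf.1.2, by simp⟩
      rw [StabilityChecks, compileExpr_final_asm]
      exact hr.1.2.1
    -- Needed to see that the branch label `nl` is below the fresh counter given to the else branch.
    have hnext := (compileCode_layout S R c₁ _ _ _ hr₁.2.2.2 hf.1.2).next_le
    have hr₂ : CompilerInputReqs S (compileExpr R C ∅ l e).final (some nl)
        (compileCode S R (compileExpr R C ∅ l e).final none (nl + 2) c₁).next c₂ := by
      refine ⟨?_, hst, ne_halt_of_compileCode hf.2, by grind⟩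
      rw [StabilityChecks, compileExpr_final_asm]
      exact hr.1.2.2.1
    exact .if_expr C l nl e c₁ c₂ _ _ _ _ _ 0 regs mds mem
      ⟨hr, ⟨_, _, _, hwhole⟩, ⟨_, compileExpr_eq hf.1.1⟩,
        ⟨_, _, _, _, _, _, compileCmd_eq hr₁ hf.1.2, compileCmd_eq hr₂ hf.2⟩⟩
      (Nat.zero_le _) hcons
      (fun regs' mds' mem' hc' _ => ih₁ _ _ _ hr₁ hf.1.2 regs' mds' mem' hc')
      (fun regs' mds' mem' hc' _ => ih₂ _ _ _ hr₂ hf.2 regs' mds' mem' hc')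
  | loop e c ih =>
    intro C l nl hr hf regs mds mem hc
    have hcons := (compileCode_layout S R (.loop e c) C l nl hr.2.2.2 hf).consistentAt_zero
      hr.2.1 hc
    have hwhole := compileCmd_eq hr hf
    simp only [compileCode, Bool.or_eq_false_iff] at hf
    have hr₁ : CompilerInputReqs S
        (compileExpr R C.flush ∅ (some (loopLabel l nl)) e).final none (exitLabel l nl + 1) c := by
      refine ⟨?_, compileExpr_final_stable R e C.flush ∅ _ (RegrecStable.flush S C) hr.1.1,
        ne_halt_of_compileCode hf.2, by simp⟩
      rw [StabilityChecks, compileExpr_final_asm]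
      exact hr.1.2.1
    -- At `pc = 0` the related command is the loop itself, not its unfolding to a conditional; hence
    -- the `rfl`.
    exact .while_expr C l nl e c _ _ _ _ _ 0 regs mds mem
      ⟨hr, ⟨_, _, _, hwhole⟩, ⟨_, compileExpr_eq hf.1⟩, ⟨_, _, _, compileCmd_eq hr₁ hf.2⟩⟩
      (Nat.zero_le _) rfl hcons
      (fun regs' mds' mem' hc' _ => ih _ _ _ hr₁ hf.2 regs' mds' mem' hc')

end Compilation

theorem mainTheorem8 {Val Var Lock Reg : Type*} [Zero Val] [Finite Var] [Finite Lock]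
    [Inhabited Reg] (S : LockSystem Val Var Lock) (R : RegAlloc Val Var Reg)
    (C C' : CompRec Val Var Lock Reg) (l l' : Option ℕ) (nl nl' : ℕ)
    (c : Cmd Val Var Lock) (PCs : AText Val Var Lock Reg) (failed : Bool)
    (regs : Reg → Val) (mds : Mds Var Lock) (mem : Mem Val Var Lock)
    (P : Text Val Var Lock Reg)
    (hcompile : ⟨PCs, l', nl', C', failed⟩ = compileCmd S R C l nl c)
    (hreqs : CompilerInputReqs S C l nl c)
    (hfailed : failed = false)
    (hconsistent : CompiledCmdConfigConsistent C regs mds mem)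
    (hP : P = PCs.map Prod.fst) :
    RefRelWR S R ⟨c, mds, mem⟩ ⟨⟨0, P, regs⟩, mds, mem⟩ := by
  subst hfailed hP
  have hf : (compileCode S R C l nl c).failed = false := by
    -- The overall flag is a disjunction of violated requirements and failed translation, so its
    -- falsity clears the second.
    have := congrArg CmdOut.failed hcompile
    simp only [compileCmd] at this
    exact (Bool.or_eq_false_iff.1 this.symm).2
  rw [compileCmd_eq hreqs hf] at hcompile
  obtain rfl : PCs = (compileCode S R C l nl c).code := congrArg CmdOut.code hcompile
  exact refRelWR_compileCode S R c C l nl hreqs hf regs mds mem hconsistent
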